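/- Let $d\in\mathbb{N}$, let $H\le \mathrm{GL}(\mathbb{R}^d)$ be a closed subgroup and let $\xi_0\in\mathbb{R}^d$ be such that the dual orbit $\mathcal{O}:=H^T\xi_0=\{h^T\xi_0 : h\in H\}$ is open with Lebesgue-null complement and the isotropy group $\{h\in H: h^T\xi_0=\xi_0\}$ is compact. Let $(h_i)_{i\in I}$ be a well-spread family in $H$, that is, there is a neighbourhood $V$ of the identity in $H$ such that the sets $h_iV$ ($i\in I$) are pairwise disjoint, and a relatively compact neighbourhood $W$ of the identity in $H$ such that $H=\bigcup_{i\in I}h_iW$. For a family $\mathcal{Q}=(Q_i)_{i\in I}$ of sets write $i^*:=\{j\in I: Q_j\cap Q_i\neq\emptyset\}$; $\mathcal{Q}$ is an *admissible covering* of a nonempty set $X$ if $X=\bigcup_{i}Q_i$ and $\sup_{i}|i^*|<\infty$. If $Q\subset\mathbb{R}^d$ is precompact with $\overline{Q}\subset\mathcal{O}$ and $\mathcal{O}=\bigcup_{i\in I}h_i^{-T}Q$, we call $\mathcal{Q}=(h_i^{-T}Q)_{i\in I}$ a *covering of $\mathcal{O}$ induced by $H$*. Then: 1. A set $Q$ with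 these properties exists. In particular, for every precompact $U\subset H$ with $H=\bigcup_{i\in I}h_iU$, the set $Q=U^{-T}\xi_0=\{g^{-T}\xi_0: g\in U\}$ has these properties. 2. Every induced covering $\mathcal{Q}=(h_i^{-T}Q)_{i\in I}$ is an admissible covering of $\mathcal{O}$, and there is a constant $C>0$, depending on $(h_i)_{i\in I}$ and $Q$, such that $\|h_i^Th_j^{-T}\|\le C$ for all $i\in I$ and $j\in i^*$. 3. Let $Q\subset\mathbb{R}^d$ be open and precompact with $\overline{Q}\subset\mathcal{O}$, and let $P\subset\mathbb{R}^d$ be open with $\overline{P}\subset Q$ and $\mathcal{O}=\bigcup_{i\in I}h_i^{-T}P$. Then $\mathcal{Q}=(h_i^{-T}Q)_{i\in I}$ is a *structured admissible covering* of $\mathcal{O}$ (with $T_i=h_i^{-T}$ and $b_i=0$): $I$ is nonempty and countable, $\mathcal{Q}=(T_iQ+b_i)_{i}$ and $(T_iP+b_i)_{i}$, where $P,Q$ are open and precompact with $\overline{P}\subset Q$, are admissible coverings of the nonempty open set $\mathcal{O}$, and there is $C>0$ with $\|T_i^{-1}T_j\|\le C$ whenever $Q_i\cap Q_j\neq\emptyset$.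 Moreover, $\mathcal{Q}$ is a *decomposition covering* of $\mathcal{O}$: it is an admissible covering of $\mathcal{O}$, all $Q_i$ are nonempty, and there is a bounded admissible partition of unity (BAPU) subordinate to $\mathcal{Q}$, i.e. a family $(\varphi_i)_{i\in I}$ in $C_c^\infty(\mathcal{O})$ with $\sum_{i\in I}\varphi_i=1$ on $\mathcal{O}$, with $\varphi_i=0$ on $\mathcal{O}\setminus Q_i$ for all $i\in I$, and with $\sup_{i\in I}\|\mathcal{F}^{-1}\varphi_i\|_{L^1(\mathbb{R}^d)}<\infty$, where $(\mathcal{F}^{-1}f)(x)=\int_{\mathbb{R}^d} f(\xi)e^{2\pi i\langle x,\xi\rangle}\,d\xi$. -/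

import Mathlib

open MeasureTheory Topology Matrix
open scoped Pointwise ContDiff FourierTransform

/-! ### Families in topological groups -/

/-- The family `g` is `U`-dense: the left translates `g j • U` cover the group. -/
def IsDenseFamily {G J : Type*} [Group G] (g : J → G) (U : Set G) : Prop :=
  ⋃ j, g j • U = Set.univ

/-- The family `g` is `U`-discrete: the left translates `g j • U` with distinct indices are
disjoint. -/
def IsDiscreteFamily {G J : Type*} [Group G] (g : J → G) (U : Set G) : Prop :=
  ∀ j j' : J, j ≠ j' → g j • U ∩ g j' • U = ∅

/-- Separated: `U`-discrete for some neighbourhood `U` of the identity. -/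
def IsSeparatedFamily {G J : Type*} [Group G] [TopologicalSpace G] (g : J → G) : Prop :=
  ∃ U ∈ 𝓝 (1 : G), IsDiscreteFamily g U

/-- Well-spread: separated, and `U`-dense for some relatively compact neighbourhood `U` of the
identity. -/
def IsWellSpread {G J : Type*} [Group G] [TopologicalSpace G] (g : J → G) : Prop :=
  IsSeparatedFamily g ∧ ∃ U ∈ 𝓝 (1 : G), IsCompact (closure U) ∧ IsDenseFamily g U

/-! ### Admissible coverings -/

/-- The index cluster `i^*` of the index `i` with respect to the family `𝒬`. -/
def indexCluster {X I : Type*} (𝒬 : I → Set X) (i : I) : Set I :=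
  {j | (𝒬 j ∩ 𝒬 i).Nonempty}

/-- `𝒬` is an admissible covering of the nonempty set `U`. -/
structure IsAdmissibleCovering {X I : Type*} (U : Set X) (𝒬 : I → Set X) : Prop where
  nonempty : U.Nonempty
  iUnion_eq : ⋃ i, 𝒬 i = U
  cluster_le : ∃ n₀ : ℕ, ∀ i, (indexCluster 𝒬 i).encard ≤ n₀

/-! ### Matrices acting on Euclidean space -/

/-- The action of a matrix on Euclidean space, as a continuous linear map; its norm is the
operator norm induced by the Euclidean norm. -/
noncomputable def matAct {d : ℕ} (A : Matrix (Fin d) (Fin d) ℝ) :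
    EuclideanSpace ℝ (Fin d) →L[ℝ] EuclideanSpace ℝ (Fin d) :=
  Matrix.toEuclideanCLM (𝕜 := ℝ) A

/-- The inverse transpose `h^{-T}` of `h`, as an element of the general linear group. -/
noncomputable def invTranspose {d : ℕ} (h : GL (Fin d) ℝ) : GL (Fin d) ℝ where
  val := (h⁻¹.val)ᵀ
  inv := (h.val)ᵀ
  val_inv := by rw [← Matrix.transpose_mul, Units.mul_inv, Matrix.transpose_one]
  inv_val := by rw [← Matrix.transpose_mul, Units.inv_mul, Matrix.transpose_one]

/-- `𝒬` is the structured admissible covering `(T_i Q + b_i)` of the nonempty open set `U`,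
with associated smaller family `(T_i P + b_i)`. -/
structure IsStructuredAdmissibleCovering {d : ℕ} {I : Type*}
    (U : Set (EuclideanSpace ℝ (Fin d))) (T : I → GL (Fin d) ℝ)
    (b : I → EuclideanSpace ℝ (Fin d)) (P Q : Set (EuclideanSpace ℝ (Fin d)))
    (𝒬 : I → Set (EuclideanSpace ℝ (Fin d))) : Prop where
  isOpen : IsOpen U
  nonempty : U.Nonempty
  index_nonempty : Nonempty I
  index_countable : Countable I
  isOpen_P : IsOpen P
  isCompact_P : IsCompact (closure P)
  isOpen_Q : IsOpen Q
  isCompact_Q : IsCompact (closure Q)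
  closure_P_subset : closure P ⊆ Q
  family_eq : ∀ i, 𝒬 i = (fun x => matAct (T i).val x + b i) '' Q
  admissible_Q : IsAdmissibleCovering U 𝒬
  admissible_P : IsAdmissibleCovering U (fun i => (fun x => matAct (T i).val x + b i) '' P)
  norm_le : ∃ C : ℝ, 0 < C ∧ ∀ i j, (𝒬 i ∩ 𝒬 j).Nonempty →
    ‖matAct ((T i)⁻¹.val * (T j).val)‖ ≤ C

/-! ### Bounded admissible partitions of unity and decomposition coverings -/

/-- `φ` is a bounded admissible partition of unity subordinate to `𝒬`. The first three fields
say that each `φ i` belongs to `C_c^∞(U)`. -/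
structure IsBAPU {d : ℕ} {I : Type*} (U : Set (EuclideanSpace ℝ (Fin d)))
    (𝒬 : I → Set (EuclideanSpace ℝ (Fin d))) (φ : I → EuclideanSpace ℝ (Fin d) → ℂ) :
    Prop where
  smooth : ∀ i, ContDiff ℝ ∞ (φ i)
  hasCompactSupport : ∀ i, HasCompactSupport (φ i)
  tsupport_subset : ∀ i, tsupport (φ i) ⊆ U
  hasSum_one : ∀ x ∈ U, HasSum (fun i => φ i x) 1
  eq_zero : ∀ i, ∀ x ∈ U \ 𝒬 i, φ i x = 0
  bounded : ⨆ i, eLpNorm (𝓕⁻ (φ i)) 1 volume < ⊤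

/-- `𝒬` is a decomposition covering of the nonempty open set `U`. -/
structure IsDecompositionCovering {d : ℕ} {I : Type*} (U : Set (EuclideanSpace ℝ (Fin d)))
    (𝒬 : I → Set (EuclideanSpace ℝ (Fin d))) : Prop where
  isOpen : IsOpen U
  nonempty : U.Nonempty
  admissible : IsAdmissibleCovering U 𝒬
  nonempty_mem : ∀ i, (𝒬 i).Nonempty
  exists_bapu : ∃ φ : I → EuclideanSpace ℝ (Fin d) → ℂ, IsBAPU U 𝒬 φ

/-! ### The dual orbit and induced coverings -/

/-- The dual orbit `H^T ξ₀`. -/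
def dualOrbit {d : ℕ} (H : Subgroup (GL (Fin d) ℝ)) (ξ₀ : EuclideanSpace ℝ (Fin d)) :
    Set (EuclideanSpace ℝ (Fin d)) :=
  {ξ | ∃ h ∈ H, ξ = matAct (h.val)ᵀ ξ₀}

/-- The standing assumptions on the dilation group: `H` is closed in `GL(ℝ^d)`, the dual orbit
of `ξ₀` is open and of full Lebesgue measure, and the isotropy group of `ξ₀` is compact. -/
structure IsAdmissibleDilationGroup {d : ℕ} (H : Subgroup (GL (Fin d) ℝ))
    (ξ₀ : EuclideanSpace ℝ (Fin d)) : Prop where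
  isClosed : IsClosed (H : Set (GL (Fin d) ℝ))
  isOpen_orbit : IsOpen (dualOrbit H ξ₀)
  full_measure : volume (dualOrbit H ξ₀)ᶜ = 0
  isCompact_isotropy : IsCompact {h : H | matAct ((h : GL (Fin d) ℝ).val)ᵀ ξ₀ = ξ₀}

/-- The family `(h_i^{-T} Q)`. -/
def orbitFamily {d : ℕ} {I : Type*} {H : Subgroup (GL (Fin d) ℝ)} (h : I → H)
    (Q : Set (EuclideanSpace ℝ (Fin d))) (i : I) : Set (EuclideanSpace ℝ (Fin d)) :=
  matAct (invTranspose (h i : GL (Fin d) ℝ)).val '' Q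

/-- The precompact set `Q`, with closure in the dual orbit, is such that `(h_i^{-T} Q)` covers
the dual orbit: for well-spread `h` this family is then a covering induced by `H`. -/
structure IsInducingSet {d : ℕ} {I : Type*} (H : Subgroup (GL (Fin d) ℝ))
    (ξ₀ : EuclideanSpace ℝ (Fin d)) (h : I → H) (Q : Set (EuclideanSpace ℝ (Fin d))) :
    Prop where
  isCompact_closure : IsCompact (closure Q)
  closure_subset : closure Q ⊆ dualOrbit H ξ₀
  orbit_eq : dualOrbit H ξ₀ = ⋃ i, orbitFamily h Q i

/-! The orbit map `g ↦ g^{-T} ξ₀` from `H` to the dual orbit is proper: it is open by the open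
mapping theorem for σ-compact groups, and its fibres are cosets of a compact isotropy group. So if
`closure Q` is a compact subset of the orbit, its preimage `K` in `H` is compact, and whenever
`h_i^{-T} Q` meets `h_j^{-T} Q`, the quotient `h_i⁻¹ h_j` lies in the compact set `K K⁻¹`.
Separatedness then bounds the number of such `j` uniformly in `i`, and continuity on `K K⁻¹` bounds
`h_i^T h_j^{-T} = (h_i⁻¹ h_j)^{-T}`. The key lemmas are `isCompact_setOf_smul_mem`,
`exists_isCompact_indexCluster` and `IsSeparatedFamily.exists_encard_le`.

For the partition of unity, take a bump `ψ` equal to 1 on `closure P` and supported in `Q`, and set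
`ψ_i = ψ ∘ h_i^T`. The norm `‖𝓕⁻ f‖₁` is submultiplicative and invariant under invertible linear
changes of variables, so all `ψ_i` have the same norm. The telescoping products `ψ_i ∏ (1 - ψ_j)`,
over the neighbours `j` of `i` preceding it in some linear order, sum to 1 and have boundedly many
factors. -/

/-! ### The norm `‖𝓕⁻ f‖₁` on smooth compactly supported functions -/

section FourierAlgebra

variable {E : Type*} [NormedAddCommGroup E] [InnerProductSpace ℝ E] [FiniteDimensional ℝ E]
  [MeasurableSpace E] [BorelSpace E]

/-- Young's inequality for the convolution of two integrable functions. -/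
theorem eLpNorm_one_convolution_mul_le {f g : E → ℂ} (hf : Integrable f) (hg : Integrable g) :
    eLpNorm (convolution f g (ContinuousLinearMap.mul ℂ ℂ) volume) 1 volume ≤
      eLpNorm f 1 volume * eLpNorm g 1 volume := by
  simp only [eLpNorm_one_eq_lintegral_enorm]
  have hmeas : AEMeasurable (fun p : E × E => ‖f p.2‖ₑ * ‖g (p.1 - p.2)‖ₑ)
      (volume.prod volume) := by
    have := (hf.convolution_integrand (ContinuousLinearMap.mul ℂ ℂ) hg).aestronglyMeasurable.enorm
    simpa [enorm_mul] using this
  calc ∫⁻ x, ‖convolution f g (ContinuousLinearMap.mul ℂ ℂ) volume x‖ₑ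
      ≤ ∫⁻ x, ∫⁻ t, ‖f t‖ₑ * ‖g (x - t)‖ₑ := by
        refine lintegral_mono fun x => ?_
        refine (enorm_integral_le_lintegral_enorm _).trans (le_of_eq ?_)
        simp [enorm_mul]
    _ = ∫⁻ t, ∫⁻ x, ‖f t‖ₑ * ‖g (x - t)‖ₑ := lintegral_lintegral_swap hmeas
    _ = ∫⁻ t, ‖f t‖ₑ * ∫⁻ x, ‖g x‖ₑ := by
        refine lintegral_congr fun t => ?_
        rw [lintegral_const_mul' _ _ enorm_ne_top, lintegral_sub_right_eq_self (fun x => ‖g x‖ₑ) t]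
    _ = (∫⁻ t, ‖f t‖ₑ) * ∫⁻ x, ‖g x‖ₑ :=
        lintegral_mul_const'' _ hf.aestronglyMeasurable.enorm

theorem integrable_fourierInv_of_hasCompactSupport {f : E → ℂ} (hf : ContDiff ℝ ∞ f)
    (hfc : HasCompactSupport f) : Integrable (𝓕⁻ f) := by
  have := (𝓕⁻ (hfc.toSchwartzMap hf)).integrable (μ := volume)
  rwa [SchwartzMap.fourierInv_coe] at this

theorem integrable_of_hasCompactSupport {f : E → ℂ} (hf : ContDiff ℝ ∞ f)
    (hfc : HasCompactSupport f) : Integrable f :=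
  hf.continuous.integrable_of_hasCompactSupport hfc

/-- On Schwartz functions the inverse Fourier transform turns products into convolutions, so this is
Young's inequality. -/
theorem eLpNorm_fourierInv_mul_le {f g : E → ℂ} (hf : ContDiff ℝ ∞ f)
    (hfc : HasCompactSupport f) (hg : ContDiff ℝ ∞ g) (hgc : HasCompactSupport g) :
    eLpNorm (𝓕⁻ (fun x => f x * g x)) 1 volume ≤
      eLpNorm (𝓕⁻ f) 1 volume * eLpNorm (𝓕⁻ g) 1 volume := by
  set F := hfc.toSchwartzMap hf
  set G := hgc.toSchwartzMap hg
  have key : 𝓕⁻ (fun x => f x * g x) =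
      convolution (𝓕⁻ f) (𝓕⁻ g) (ContinuousLinearMap.mul ℂ ℂ) volume := by
    have h1 : (fun x => f x * g x) =
        SchwartzMap.pairing (ContinuousLinearMap.mul ℂ ℂ) F G := by
      ext x; rfl
    have h2 : SchwartzMap.pairing (ContinuousLinearMap.mul ℂ ℂ) F G =
        𝓕 (SchwartzMap.convolution (ContinuousLinearMap.mul ℂ ℂ) (𝓕⁻ F) (𝓕⁻ G)) := by
      rw [SchwartzMap.fourier_convolution]; simp
    rw [h1, ← SchwartzMap.fourierInv_coe, h2, FourierTransform.fourierInv_fourier_eq]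
    ext x
    rw [SchwartzMap.convolution_apply, SchwartzMap.fourierInv_coe, SchwartzMap.fourierInv_coe]
    rfl
  rw [key]
  exact eLpNorm_one_convolution_mul_le (integrable_fourierInv_of_hasCompactSupport hf hfc)
    (integrable_fourierInv_of_hasCompactSupport hg hgc)

theorem fourierInv_sub_of_integrable {f g : E → ℂ} (hf : Integrable f) (hg : Integrable g) :
    𝓕⁻ (fun x => f x - g x) = 𝓕⁻ f - 𝓕⁻ g := by
  ext x
  simp only [Pi.sub_apply, Real.fourierInv_eq, smul_sub]
  have aux : ∀ {u : E → ℂ}, Integrable u →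
      Integrable (fun v => Real.fourierChar (inner ℝ v x) • u v) := by
    intro u hu
    have := (Real.fourierIntegral_convergent_iff (-x)).2 hu
    simpa using this
  exact integral_sub (aux hf) (aux hg)

/-- The factor `1 - g` is not compactly supported, so the product is treated as `f - f g`. -/
theorem eLpNorm_fourierInv_mul_one_sub_le {f g : E → ℂ} (hf : ContDiff ℝ ∞ f)
    (hfc : HasCompactSupport f) (hg : ContDiff ℝ ∞ g) (hgc : HasCompactSupport g) :
    eLpNorm (𝓕⁻ (fun x => f x * (1 - g x))) 1 volume ≤
      eLpNorm (𝓕⁻ f) 1 volume * (1 + eLpNorm (𝓕⁻ g) 1 volume) := by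
  have hfg : ContDiff ℝ ∞ (fun x => f x * g x) := hf.mul hg
  have hfgc : HasCompactSupport (fun x => f x * g x) := hfc.mul_right
  have h1 : (fun x => f x * (1 - g x)) = fun x => f x - f x * g x := by ext x; ring
  rw [h1, fourierInv_sub_of_integrable (integrable_of_hasCompactSupport hf hfc)
    (integrable_of_hasCompactSupport hfg hfgc), mul_add, mul_one]
  refine (eLpNorm_sub_le (integrable_fourierInv_of_hasCompactSupport hf hfc).aestronglyMeasurable
    (integrable_fourierInv_of_hasCompactSupport hfg hfgc).aestronglyMeasurable le_rfl).trans ?_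
  gcongr
  exact eLpNorm_fourierInv_mul_le hf hfc hg hgc

theorem eLpNorm_fourierInv_mul_prod_one_sub_le {ι : Type*} {f : E → ℂ} {g : ι → E → ℂ}
    (hf : ContDiff ℝ ∞ f) (hfc : HasCompactSupport f) (hg : ∀ i, ContDiff ℝ ∞ (g i))
    (hgc : ∀ i, HasCompactSupport (g i)) {B : ENNReal}
    (hB : ∀ i, eLpNorm (𝓕⁻ (g i)) 1 volume ≤ B) (s : Finset ι) :
    eLpNorm (𝓕⁻ (fun x => f x * ∏ j ∈ s, (1 - g j x))) 1 volume ≤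
      eLpNorm (𝓕⁻ f) 1 volume * (1 + B) ^ s.card := by
  classical
  induction s using Finset.induction_on with
  | empty => simp
  | insert a s ha ih =>
    have h1 : (fun x => f x * ∏ j ∈ insert a s, (1 - g j x)) =
        fun x => (f x * ∏ j ∈ s, (1 - g j x)) * (1 - g a x) := by
      ext x; rw [Finset.prod_insert ha]; ring
    rw [h1, Finset.card_insert_of_notMem ha, pow_succ, ← mul_assoc]
    refine (eLpNorm_fourierInv_mul_one_sub_le (hf.mul ?_) hfc.mul_right (hg a) (hgc a)).trans ?_
    · exact contDiff_prod fun j _ => contDiff_const.sub (hg j)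
    · gcongr
      exact hB a

theorem map_continuousLinearEquiv_volume (L : E ≃L[ℝ] E) :
    Measure.map L (volume : Measure E) =
      ENNReal.ofReal |(LinearMap.det (L : E →ₗ[ℝ] E))⁻¹| • volume :=
  Measure.map_linearMap_addHaar_eq_smul_addHaar volume (LinearEquiv.isUnit_det' L.toLinearEquiv).ne_zero

/-- The `L¹`-norm of the inverse Fourier transform is invariant under invertible linear changes
of variables. -/
theorem eLpNorm_fourierInv_comp_linear (L M : E ≃L[ℝ] E)
    (hLM : ∀ x y, inner ℝ (L x) y = inner ℝ x (M y)) (f : E → ℂ) :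
    eLpNorm (𝓕⁻ (fun x => f (L x))) 1 volume = eLpNorm (𝓕⁻ f) 1 volume := by
  set c : ℝ := |(LinearMap.det (L : E →ₗ[ℝ] E))⁻¹| with hc
  have hdetL : LinearMap.det (L : E →ₗ[ℝ] E) ≠ 0 :=
    (LinearEquiv.isUnit_det' L.toLinearEquiv).ne_zero
  -- `M` is the adjoint of `L`, so both changes of variables below produce the same factor `c`,
  -- which finally cancels.
  have hdet : LinearMap.det (M : E →ₗ[ℝ] E) = LinearMap.det (L : E →ₗ[ℝ] E) := by
    have hadj : (M : E →ₗ[ℝ] E) = LinearMap.adjoint (L : E →ₗ[ℝ] E) := by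
      rw [LinearMap.eq_adjoint_iff]
      intro x y
      have := hLM y x
      rw [real_inner_comm, ← real_inner_comm x]
      exact this.symm
    rw [hadj, ← LinearMap.det_toMatrix (stdOrthonormalBasis ℝ E).toBasis,
      ← LinearMap.det_toMatrix (stdOrthonormalBasis ℝ E).toBasis, LinearMap.toMatrix_adjoint,
      Matrix.det_conjTranspose, star_trivial]
  -- Evaluating at `M y` turns the phase `⟨x, M y⟩` into `⟨L x, y⟩`, ready for the substitution `w =
  -- L x`.
  have key : ∀ y, 𝓕⁻ (fun x => f (L x)) (M y) = c • 𝓕⁻ f y := by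
    intro y
    simp only [Real.fourierInv_eq, ← hLM]
    have h1 := integral_map_equiv (μ := (volume : Measure E))
      L.toHomeomorph.toMeasurableEquiv
      (fun w => Real.fourierChar (inner ℝ w y) • f w)
    have h2 : Measure.map L.toHomeomorph.toMeasurableEquiv (volume : Measure E) =
        ENNReal.ofReal c • volume := map_continuousLinearEquiv_volume L
    rw [h2, integral_smul_measure, ENNReal.toReal_ofReal (abs_nonneg _)] at h1
    exact h1.symm
  have hM : ∀ u : E → ENNReal, ∫⁻ y, u (M y) = ENNReal.ofReal c * ∫⁻ y, u y := by
    intro u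
    have h1 := lintegral_map_equiv (μ := (volume : Measure E)) u
      M.toHomeomorph.toMeasurableEquiv
    have h2 : Measure.map M.toHomeomorph.toMeasurableEquiv (volume : Measure E) =
        ENNReal.ofReal c • volume := by
      rw [hc, ← hdet]; exact map_continuousLinearEquiv_volume M
    rw [h2, lintegral_smul_measure] at h1
    exact h1.symm
  have hc0 : ENNReal.ofReal c ≠ 0 := by
    rw [ne_eq, ENNReal.ofReal_eq_zero, not_le, hc]
    exact abs_pos.2 (inv_ne_zero hdetL)
  simp only [eLpNorm_one_eq_lintegral_enorm]
  refine (ENNReal.mul_right_inj hc0 ENNReal.ofReal_ne_top).1 ?_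
  rw [← hM fun y => ‖𝓕⁻ (fun x => f (L x)) y‖ₑ, ← lintegral_const_mul' _ _ ENNReal.ofReal_ne_top]
  refine lintegral_congr fun y => ?_
  rw [key, enorm_smul, Real.enorm_eq_ofReal (abs_nonneg _)]

end FourierAlgebra

/-! ### Proper orbit maps and separated families in groups -/

section Groups

/-- For a transitive action with compact stabilizer of a locally compact σ-compact group on a Baire
space, the orbit map is proper. -/
theorem isCompact_setOf_smul_mem {G X : Type*} [Group G] [TopologicalSpace G]
    [IsTopologicalGroup G] [LocallyCompactSpace G] [SigmaCompactSpace G] [TopologicalSpace X]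
    [T2Space X] [BaireSpace X] [MulAction G X] [ContinuousSMul G X] [MulAction.IsPretransitive G X]
    {x : X} (hx : IsCompact (MulAction.stabilizer G x : Set G)) {K : Set X} (hK : IsCompact K) :
    IsCompact {g : G | g • x ∈ K} := by
  have hopen := isOpenMap_smul_of_sigmaCompact (G := G) x
  have hcont : Continuous fun g : G => g • x := by fun_prop
  -- The orbit map is open and onto, so the images of the interiors of an exhaustion form an
  -- increasing open cover. One of them contains `K`, hence the preimage of `K` lies in a compact
  -- set times the stabilizer.
  have hE := CompactExhaustion.choice G
  obtain ⟨n, hn⟩ := hK.elim_directed_cover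
    (fun n => (fun g : G => g • x) '' interior (hE n)) (fun n => hopen _ isOpen_interior)
    (fun y _ => by
      obtain ⟨g, rfl⟩ := MulAction.exists_smul_eq G x y
      obtain ⟨n, hn⟩ := hE.exists_mem g
      exact Set.mem_iUnion.2 ⟨n + 1, g, hE.subset_interior_succ n hn, rfl⟩)
    (directed_of_isDirected_le fun m n hmn =>
      Set.image_mono (interior_mono (hE.subset hmn)))
  refine ((hE.isCompact n).mul hx).of_isClosed_subset (hK.isClosed.preimage hcont) ?_
  intro g hg
  obtain ⟨k, hk, hkg⟩ := hn hg
  refine Set.mem_mul.2 ⟨k, interior_subset hk, k⁻¹ * g, ?_, by simp⟩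
  change (k⁻¹ * g) • x = x
  rw [mul_smul, inv_smul_eq_iff]
  exact hkg.symm

/-- Finitely many translates of `V⁻¹` cover `M`. If `a * g j` and `a * g j'` lie in the same
translate, labelled `k`, then `(k * a)⁻¹` belongs to both `g j • V` and `g j' • V`, so `j = j'`. The
number of translates does not depend on `a`. -/
theorem IsSeparatedFamily.exists_encard_le {G J : Type*} [Group G] [TopologicalSpace G]
    [IsTopologicalGroup G] {g : J → G} (hg : IsSeparatedFamily g) {M : Set G} (hM : IsCompact M) :
    ∃ n : ℕ, ∀ a : G, {j | a * g j ∈ M}.encard ≤ n := by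
  obtain ⟨V, hV, hdisj⟩ := hg
  have hV' : (interior V⁻¹).Nonempty :=
    ⟨1, mem_interior_iff_mem_nhds.2 (by simpa using inv_mem_nhds_one G hV)⟩
  obtain ⟨t, ht⟩ := compact_covered_by_mul_left_translates hM hV'
  refine ⟨t.card, fun a => ?_⟩
  have hex : ∀ j, ∃ k, a * g j ∈ M → k ∈ t ∧ (k * (a * g j))⁻¹ ∈ V := by
    intro j
    by_cases hj : a * g j ∈ M
    · obtain ⟨k, hk, hkj⟩ := Set.mem_iUnion₂.1 (ht hj)
      exact ⟨k, fun _ => ⟨hk, hkj⟩⟩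
    · exact ⟨1, fun h => absurd h hj⟩
  choose k hk using hex
  rw [← Set.encard_coe_eq_coe_finsetCard]
  refine Set.encard_le_encard_of_injOn (f := k) (fun j hj => (hk j hj).1) ?_
  intro j hj j' hj' hjj'
  by_contra hne
  have h1 : (k j * a)⁻¹ ∈ g j • V :=
    Set.mem_smul_set.2 ⟨_, (hk j hj).2, by simp [smul_eq_mul, mul_assoc]⟩
  have h2 : (k j * a)⁻¹ ∈ g j' • V :=
    Set.mem_smul_set.2 ⟨_, (hk j' hj').2, by rw [hjj']; simp [smul_eq_mul, mul_assoc]⟩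
  exact (Set.disjoint_iff_inter_eq_empty.2 (hdisj j j' hne)).le_bot ⟨h1, h2⟩

theorem IsSeparatedFamily.countable {G J : Type*} [Group G] [TopologicalSpace G]
    [IsTopologicalGroup G] [SigmaCompactSpace G] {g : J → G} (hg : IsSeparatedFamily g) :
    Countable J := by
  have : (Set.univ : Set J) = ⋃ n, {j | 1 * g j ∈ compactCovering G n} := by
    ext j
    simpa using exists_mem_compactCovering (g j)
  rw [← Set.countable_univ_iff, this]
  refine Set.countable_iUnion fun n => ?_
  obtain ⟨m, hm⟩ := hg.exists_encard_le (isCompact_compactCovering G n)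
  exact (Set.finite_of_encard_le_coe (hm 1)).countable

theorem IsDenseFamily.nonempty {G J : Type*} [Group G] {g : J → G} {U : Set G}
    (hg : IsDenseFamily g U) : Nonempty J := by
  have : (1 : G) ∈ ⋃ j, g j • U := by rw [hg]; trivial
  exact ⟨(Set.mem_iUnion.1 this).choose⟩

end Groups

/-! ### The contragredient action on the dual orbit -/

section DualAction

variable {d : ℕ}

theorem matAct_mul_apply (A B : Matrix (Fin d) (Fin d) ℝ) (x : EuclideanSpace ℝ (Fin d)) :
    matAct (A * B) x = matAct A (matAct B x) := by
  simp [matAct, map_mul]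

theorem matAct_one_apply (x : EuclideanSpace ℝ (Fin d)) :
    matAct (1 : Matrix (Fin d) (Fin d) ℝ) x = x := by
  simp [matAct]

theorem continuous_matAct :
    Continuous (matAct : Matrix (Fin d) (Fin d) ℝ → _) := by
  have : Continuous (Matrix.toEuclideanCLM (n := Fin d) (𝕜 := ℝ)).toAlgEquiv.toLinearEquiv.toLinearMap :=
    LinearMap.continuous_of_finiteDimensional _
  exact this

theorem inner_matAct_left (A : Matrix (Fin d) (Fin d) ℝ) (x y : EuclideanSpace ℝ (Fin d)) :
    inner ℝ (matAct A x) y = inner ℝ x (matAct Aᵀ y) := by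
  have : matAct Aᵀ = ContinuousLinearMap.adjoint (matAct A) := by
    rw [← ContinuousLinearMap.star_eq_adjoint, matAct, matAct, ← map_star]
    rfl
  rw [this, ContinuousLinearMap.adjoint_inner_right]

theorem invTranspose_mul (g h : GL (Fin d) ℝ) :
    invTranspose (g * h) = invTranspose g * invTranspose h := by
  ext1
  simp [invTranspose, Matrix.transpose_mul]

theorem invTranspose_one : invTranspose (1 : GL (Fin d) ℝ) = 1 := by
  ext1
  simp [invTranspose]

theorem matAct_invTranspose_mul_apply (g h : GL (Fin d) ℝ) (x : EuclideanSpace ℝ (Fin d)) :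
    matAct (invTranspose (g * h)).val x =
      matAct (invTranspose g).val (matAct (invTranspose h).val x) := by
  rw [invTranspose_mul, Units.val_mul, matAct_mul_apply]

theorem matAct_invTranspose_one_apply (x : EuclideanSpace ℝ (Fin d)) :
    matAct (invTranspose (1 : GL (Fin d) ℝ)).val x = x := by
  rw [invTranspose_one, Units.val_one, matAct_one_apply]

theorem continuous_val_invTranspose :
    Continuous fun g : GL (Fin d) ℝ => (invTranspose g).val :=
  (Units.continuous_val.comp continuous_inv).matrix_transpose

/-- The invertible linear map of Euclidean space given by an invertible matrix. -/
noncomputable def matActEquiv (g : GL (Fin d) ℝ) :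
    EuclideanSpace ℝ (Fin d) ≃L[ℝ] EuclideanSpace ℝ (Fin d) :=
  ContinuousLinearEquiv.equivOfInverse (matAct g.val) (matAct g⁻¹.val)
    (fun x => by rw [← matAct_mul_apply, Units.inv_mul, matAct_one_apply])
    (fun x => by rw [← matAct_mul_apply, Units.mul_inv, matAct_one_apply])

variable (H : Subgroup (GL (Fin d) ℝ)) (ξ₀ : EuclideanSpace ℝ (Fin d))

theorem matAct_transpose_invTranspose (g : GL (Fin d) ℝ) (x : EuclideanSpace ℝ (Fin d)) :
    matAct (g.val)ᵀ (matAct (invTranspose g).val x) = x := by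
  rw [← matAct_mul_apply]
  exact (congrArg (fun A => matAct A x) (invTranspose g).inv_val).trans (matAct_one_apply x)

theorem matAct_invTranspose_transpose (g : GL (Fin d) ℝ) (x : EuclideanSpace ℝ (Fin d)) :
    matAct (invTranspose g).val (matAct (g.val)ᵀ x) = x := by
  rw [← matAct_mul_apply]
  exact (congrArg (fun A => matAct A x) (invTranspose g).val_inv).trans (matAct_one_apply x)

theorem mem_dualOrbit_self : ξ₀ ∈ dualOrbit H ξ₀ :=
  ⟨1, H.one_mem, by simp [matAct_one_apply]⟩

variable {H ξ₀}

theorem matAct_invTranspose_mem_dualOrbit {x : EuclideanSpace ℝ (Fin d)} (g : H)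
    (hx : x ∈ dualOrbit H ξ₀) : matAct (invTranspose (g : GL (Fin d) ℝ)).val x ∈ dualOrbit H ξ₀ := by
  obtain ⟨k, hk, rfl⟩ := hx
  refine ⟨k * (g : GL (Fin d) ℝ)⁻¹, H.mul_mem hk (H.inv_mem g.2), ?_⟩
  rw [← matAct_mul_apply, Units.val_mul, Matrix.transpose_mul]
  rfl

theorem exists_eq_matAct_invTranspose {x : EuclideanSpace ℝ (Fin d)} (hx : x ∈ dualOrbit H ξ₀) :
    ∃ g : H, matAct (invTranspose (g : GL (Fin d) ℝ)).val ξ₀ = x := by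
  obtain ⟨k, hk, rfl⟩ := hx
  refine ⟨⟨k⁻¹, H.inv_mem hk⟩, ?_⟩
  simp [invTranspose]

variable (H ξ₀)

/-- The contragredient action of `H` on the dual orbit. -/
@[reducible] noncomputable def dualOrbitAction : MulAction H (dualOrbit H ξ₀) where
  smul g x := ⟨matAct (invTranspose (g : GL (Fin d) ℝ)).val x,
    matAct_invTranspose_mem_dualOrbit g x.2⟩
  one_smul x := Subtype.ext (matAct_invTranspose_one_apply x.1)
  mul_smul g h x := Subtype.ext (matAct_invTranspose_mul_apply g.1 h.1 x.1)

theorem continuous_matAct_invTranspose :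
    Continuous fun g : H => matAct (invTranspose (g : GL (Fin d) ℝ)).val :=
  continuous_matAct.comp (continuous_val_invTranspose.comp continuous_subtype_val)

theorem continuous_matAct_invTranspose_apply :
    Continuous fun p : H × EuclideanSpace ℝ (Fin d) =>
      matAct (invTranspose (p.1 : GL (Fin d) ℝ)).val p.2 :=
  ((continuous_matAct_invTranspose H).comp continuous_fst).clm_apply continuous_snd

variable {H ξ₀}

theorem isClosed_locallyCompact_sigmaCompact (hH : IsClosed (H : Set (GL (Fin d) ℝ))) :
    LocallyCompactSpace H ∧ SigmaCompactSpace H := by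
  have h1 : IsClosedEmbedding ((↑) : H → GL (Fin d) ℝ) := hH.isClosedEmbedding_subtypeVal
  have : LocallyCompactSpace (Matrix (Fin d) (Fin d) ℝ) :=
    inferInstanceAs (LocallyCompactSpace (Fin d → Fin d → ℝ))
  have : SigmaCompactSpace (Matrix (Fin d) (Fin d) ℝ) :=
    inferInstanceAs (SigmaCompactSpace (Fin d → Fin d → ℝ))
  have : SigmaCompactSpace (Matrix (Fin d) (Fin d) ℝ)ᵐᵒᵖ :=
    MulOpposite.opHomeomorph.symm.isClosedEmbedding.sigmaCompactSpace
  -- The map `g ↦ (g, g⁻¹)` makes the general linear group closed in a σ-compact space.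
  have h2 := Units.isClosedEmbedding_embedProduct (α := Matrix (Fin d) (Fin d) ℝ)
  exact ⟨h1.locallyCompactSpace, (h2.comp h1).sigmaCompactSpace⟩

/-- Properness of the orbit map. The orbit is open, hence locally compact and Baire, and `h^T` fixes
`ξ₀` exactly when `h^{-T}` does, so the stabilizer is the compact isotropy group. -/
theorem IsAdmissibleDilationGroup.isCompact_setOf_mem (hH : IsAdmissibleDilationGroup H ξ₀)
    {K : Set (EuclideanSpace ℝ (Fin d))} (hK : IsCompact K) (hKO : K ⊆ dualOrbit H ξ₀) :
    IsCompact {g : H | matAct (invTranspose (g : GL (Fin d) ℝ)).val ξ₀ ∈ K} := by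
  obtain ⟨_, _⟩ := isClosed_locallyCompact_sigmaCompact hH.isClosed
  let _ := dualOrbitAction H ξ₀
  have : ContinuousSMul H (dualOrbit H ξ₀) :=
    ⟨((continuous_matAct_invTranspose_apply H).comp
      (continuous_fst.prodMk (continuous_subtype_val.comp continuous_snd))).subtype_mk _⟩
  have : LocallyCompactSpace (dualOrbit H ξ₀) := hH.isOpen_orbit.locallyCompactSpace
  let x₀ : dualOrbit H ξ₀ := ⟨ξ₀, mem_dualOrbit_self H ξ₀⟩
  have : MulAction.IsPretransitive H (dualOrbit H ξ₀) :=
    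
    (MulAction.isPretransitive_iff_base x₀).2 fun x => by
      obtain ⟨g, hg⟩ := exists_eq_matAct_invTranspose x.2
      exact ⟨g, Subtype.ext hg⟩
  have hstab : IsCompact (MulAction.stabilizer H x₀ : Set H) := by
    convert hH.isCompact_isotropy using 1
    ext g
    change g • x₀ = x₀ ↔ _
    rw [Subtype.ext_iff]
    change matAct (invTranspose (g : GL (Fin d) ℝ)).val ξ₀ = ξ₀ ↔ matAct _ ξ₀ = ξ₀
    constructor
    · intro h
      conv_lhs => rw [← h]
      exact matAct_transpose_invTranspose _ _
    · intro h
      conv_lhs => rw [← h]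
      exact matAct_invTranspose_transpose _ _
  exact isCompact_setOf_smul_mem hstab
    (Topology.IsInducing.subtypeVal.isCompact_preimage' hK (by simpa using hKO))

end DualAction

/-! ### Admissibility of induced coverings -/

section InducedCoverings

variable {d : ℕ} {H : Subgroup (GL (Fin d) ℝ)} {ξ₀ : EuclideanSpace ℝ (Fin d)} {I : Type*}
  {h : I → H}

theorem isInducingSet_image {U : Set H} (hU : IsCompact (closure U)) (hd : IsDenseFamily h U) :
    IsInducingSet H ξ₀ h
      ((fun g : H => matAct (invTranspose (g : GL (Fin d) ℝ)).val ξ₀) '' U) := by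
  have hcont : Continuous fun g : H => matAct (invTranspose (g : GL (Fin d) ℝ)).val ξ₀ :=
    (continuous_matAct_invTranspose H).clm_apply continuous_const
  have hK := hU.image hcont
  have hsub := closure_minimal (Set.image_mono subset_closure) hK.isClosed
  refine ⟨hK.of_isClosed_subset isClosed_closure hsub, hsub.trans ?_, ?_⟩
  · rintro _ ⟨g, -, rfl⟩
    exact matAct_invTranspose_mem_dualOrbit g (mem_dualOrbit_self H ξ₀)
  · apply Set.Subset.antisymm
    · intro x hx
      obtain ⟨g, rfl⟩ := exists_eq_matAct_invTranspose hx
      have hg : g ∈ ⋃ j, h j • U := by rw [hd]; trivial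
      obtain ⟨i, u, hu, hiu⟩ := Set.mem_iUnion.1 hg
      refine Set.mem_iUnion.2 ⟨i, _, ⟨u, hu, rfl⟩, ?_⟩
      rw [← hiu]
      exact (matAct_invTranspose_mul_apply (h i : GL (Fin d) ℝ) u ξ₀).symm
    · refine Set.iUnion_subset fun i => ?_
      rintro _ ⟨_, ⟨u, -, rfl⟩, rfl⟩
      exact matAct_invTranspose_mem_dualOrbit _
        (matAct_invTranspose_mem_dualOrbit u (mem_dualOrbit_self H ξ₀))

/-- Neighbouring indices of an induced family differ by an element of a fixed compact set. -/
theorem IsAdmissibleDilationGroup.exists_isCompact_indexCluster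
    (hH : IsAdmissibleDilationGroup H ξ₀) (h : I → H) {Q : Set (EuclideanSpace ℝ (Fin d))}
    (hQ : IsCompact (closure Q)) (hQO : closure Q ⊆ dualOrbit H ξ₀) :
    ∃ M : Set H, IsCompact M ∧
      ∀ i, ∀ j ∈ indexCluster (orbitFamily h Q) i, (h i)⁻¹ * h j ∈ M := by
  have hK := hH.isCompact_setOf_mem hQ hQO
  -- A common point gives `h_j^{-T} q = h_i^{-T} q'` with `q, q' ∈ Q`. Writing `q = k^{-T} ξ₀`, both
  -- `k` and `h_i⁻¹ h_j k` lie in the compact preimage of `closure Q`.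
  refine ⟨_, hK.mul hK.inv, fun i j hij => ?_⟩
  obtain ⟨_, ⟨q, hq, rfl⟩, ⟨q', hq', heq⟩⟩ := hij
  obtain ⟨k, hk⟩ := exists_eq_matAct_invTranspose (hQO (subset_closure hq))
  refine Set.mem_mul.2 ⟨(h i)⁻¹ * h j * k, ?_, k⁻¹, ?_, by simp⟩
  · have : matAct (invTranspose (((h i)⁻¹ * h j * k : H) : GL (Fin d) ℝ)).val ξ₀ = q' := by
      simp only [Subgroup.coe_mul]
      rw [matAct_invTranspose_mul_apply, matAct_invTranspose_mul_apply, hk]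
      rw [← heq, ← matAct_invTranspose_mul_apply, Subgroup.coe_inv, inv_mul_cancel,
        matAct_invTranspose_one_apply]
    change _ ∈ closure Q
    rw [this]
    exact subset_closure hq'
  · rw [Set.mem_inv, inv_inv]
    change _ ∈ closure Q
    rw [hk]
    exact subset_closure hq

theorem IsAdmissibleDilationGroup.isAdmissibleCovering (hH : IsAdmissibleDilationGroup H ξ₀)
    (hh : IsSeparatedFamily h) {Q : Set (EuclideanSpace ℝ (Fin d))}
    (hQ : IsInducingSet H ξ₀ h Q) :
    IsAdmissibleCovering (dualOrbit H ξ₀) (orbitFamily h Q) := by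
  obtain ⟨M, hM, hMi⟩ :=
    hH.exists_isCompact_indexCluster h hQ.isCompact_closure hQ.closure_subset
  obtain ⟨n, hn⟩ := hh.exists_encard_le hM
  exact ⟨⟨ξ₀, mem_dualOrbit_self H ξ₀⟩, hQ.orbit_eq.symm, n, fun i =>
    (Set.encard_le_encard fun j hj => hMi i j hj).trans (hn (h i)⁻¹)⟩

theorem IsAdmissibleDilationGroup.exists_norm_le (hH : IsAdmissibleDilationGroup H ξ₀)
    {Q : Set (EuclideanSpace ℝ (Fin d))} (hQ : IsInducingSet H ξ₀ h Q) :
    ∃ C : ℝ, 0 < C ∧ ∀ i, ∀ j ∈ indexCluster (orbitFamily h Q) i,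
      ‖matAct (((h i : GL (Fin d) ℝ).val)ᵀ * (invTranspose (h j : GL (Fin d) ℝ)).val)‖ ≤ C := by
  obtain ⟨M, hM, hMi⟩ :=
    hH.exists_isCompact_indexCluster h hQ.isCompact_closure hQ.closure_subset
  obtain ⟨C, hC⟩ := hM.exists_bound_of_continuousOn (continuous_matAct_invTranspose H).continuousOn
  -- The maximum with 1 only secures positivity of the constant.
  refine ⟨max C 1, by positivity, fun i j hij => le_max_of_le_left ?_⟩
  have := hC _ (hMi i j hij)
  rw [Subgroup.coe_mul, invTranspose_mul, Units.val_mul, Subgroup.coe_inv] at this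
  simpa [invTranspose] using this

end InducedCoverings

/-! ### Bounded admissible partitions of unity -/

section PartitionOfUnity

theorem exists_contDiff_one_on_tsupport_subset {E : Type*} [NormedAddCommGroup E] [NormedSpace ℝ E]
    [FiniteDimensional ℝ E] {K Q : Set E} (hK : IsClosed K) (hQ : IsOpen Q)
    (hQc : IsCompact (closure Q)) (hKQ : K ⊆ Q) :
    ∃ ψ : E → ℂ, ContDiff ℝ ∞ ψ ∧ HasCompactSupport ψ ∧ tsupport ψ ⊆ Q ∧ ∀ x ∈ K, ψ x = 1 := by
  obtain ⟨f, hf0, hf1, -⟩ := exists_contMDiffMap_zero_one_nhds_of_isClosed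
    (modelWithCornersSelf ℝ E) (n := (⊤ : ℕ∞)) hQ.isClosed_compl hK
    (Set.disjoint_left.2 fun x hx hx' => hx (hKQ hx'))
  have hsupp : tsupport (fun x => (f x : ℂ)) ⊆ Q := by
    intro x hx
    by_contra hxQ
    refine notMem_tsupport_iff_eventuallyEq.2 ?_ hx
    filter_upwards [hf0.filter_mono (nhds_le_nhdsSet hxQ)] with y hy
    simp [hy]
  refine ⟨fun x => (f x : ℂ), Complex.ofRealCLM.contDiff.comp f.contMDiff.contDiff,
    hQc.of_isClosed_subset (isClosed_tsupport _) (hsupp.trans subset_closure), hsupp,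
    fun x hx => ?_⟩
  simp [hf1.self_of_nhdsSet x hx]

/-- An admissible covering carries a bounded admissible partition of unity as soon as it admits
bump functions that are bounded in the Fourier algebra. -/
theorem exists_isBAPU_of_bump {d : ℕ} {I : Type*} {U : Set (EuclideanSpace ℝ (Fin d))}
    {𝒬 : I → Set (EuclideanSpace ℝ (Fin d))} (h𝒬 : IsAdmissibleCovering U 𝒬)
    {ψ : I → EuclideanSpace ℝ (Fin d) → ℂ} (hψ : ∀ i, ContDiff ℝ ∞ (ψ i))
    (hψc : ∀ i, HasCompactSupport (ψ i)) (hψs : ∀ i, tsupport (ψ i) ⊆ 𝒬 i)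
    (hψ1 : ∀ x ∈ U, ∃ i, ψ i x = 1) {B : ENNReal} (hB : B ≠ ⊤)
    (hψB : ∀ i, eLpNorm (𝓕⁻ (ψ i)) 1 volume ≤ B) :
    ∃ φ : I → EuclideanSpace ℝ (Fin d) → ℂ, IsBAPU U 𝒬 φ := by
  classical
  -- Any linear order serves: at each point only finitely many bumps are nonzero.
  let _ : LinearOrder I := linearOrderOfSTO WellOrderingRel
  obtain ⟨n, hn⟩ := h𝒬.cluster_le
  have hfin : ∀ i, (indexCluster 𝒬 i).Finite := fun i => Set.finite_of_encard_le_coe (hn i)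
  have hzero : ∀ i x, x ∉ 𝒬 i → ψ i x = 0 := fun i x hx =>
    image_eq_zero_of_notMem_tsupport fun hx' => hx (hψs i hx')
  -- Only neighbours of `i` are kept: where `ψ i` is nonzero, every other factor `1 - ψ j` equals 1.
  -- This bounds the number of factors by `n`.
  let s : I → Finset I := fun i => (hfin i).toFinset.filter (· < i)
  have hs : ∀ i, (s i).card ≤ n := fun i => by
    have h1 := hn i
    rw [(hfin i).encard_eq_coe_toFinset_card, Nat.cast_le] at h1
    exact (Finset.card_filter_le _ _).trans h1
  refine ⟨fun i x => ψ i x * ∏ j ∈ s i, (1 - ψ j x), ?_, ?_, ?_, ?_, ?_, ?_⟩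
  · exact fun i => (hψ i).mul (contDiff_prod fun j _ => contDiff_const.sub (hψ j))
  · exact fun i => (hψc i).mul_right
  · refine fun i => (tsupport_mul_subset_left.trans (hψs i)).trans ?_
    rw [← h𝒬.iUnion_eq]
    exact Set.subset_iUnion 𝒬 i
  · intro x hx
    obtain ⟨i₀, hi₀⟩ := hψ1 x hx
    have hxi₀ : x ∈ 𝒬 i₀ := by
      by_contra hx'
      rw [hzero i₀ x hx'] at hi₀
      exact zero_ne_one hi₀
    have hSfin : {j | x ∈ 𝒬 j}.Finite := (hfin i₀).subset fun j hj => ⟨x, hj, hxi₀⟩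
    let S := hSfin.toFinset
    have hmemS : ∀ j, j ∈ S ↔ x ∈ 𝒬 j := fun j => by simp [S]
    have hprod : ∏ j ∈ S, (1 - ψ j x) = 0 :=
      Finset.prod_eq_zero ((hmemS i₀).2 hxi₀) (by rw [hi₀, sub_self])
    -- Telescoping: `∏ (1 - ψ_j) = 1 - ∑ ψ_i ∏_{j < i} (1 - ψ_j)` over the indices `S` active at
    -- `x`, and the left side vanishes because `ψ i₀ x = 1`.
    have hsum : ∑ i ∈ S, ψ i x * ∏ j ∈ s i, (1 - ψ j x) = 1 := by
      rw [Finset.prod_one_sub_ordered, sub_eq_zero] at hprod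
      refine Eq.trans ?_ hprod.symm
      refine Finset.sum_congr rfl fun i hi => ?_
      congr 1
      symm
      refine Finset.prod_subset (f := fun j => 1 - ψ j x) (fun j hj => ?_) fun j hj hj' => ?_
      · rw [Finset.mem_filter] at hj ⊢
        exact ⟨(hfin i).mem_toFinset.2 ⟨x, (hmemS j).1 hj.1, (hmemS i).1 hi⟩, hj.2⟩
      · rw [Finset.mem_filter] at hj hj'
        rw [hzero j x fun hxj => hj' ⟨(hmemS j).2 hxj, hj.2⟩, sub_zero]
    have hhas : HasSum (fun i => ψ i x * ∏ j ∈ s i, (1 - ψ j x))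
        (∑ i ∈ S, ψ i x * ∏ j ∈ s i, (1 - ψ j x)) := by
      refine hasSum_sum_of_ne_finset_zero fun i hi => ?_
      rw [hzero i x fun hxi => hi ((hmemS i).2 hxi), zero_mul]
    rwa [hsum] at hhas
  · intro i x hx
    rw [hzero i x hx.2, zero_mul]
  · refine lt_of_le_of_lt (iSup_le fun i => ?_) (b := B * (1 + B) ^ n)
      (ENNReal.mul_lt_top hB.lt_top (ENNReal.pow_lt_top (by simpa using hB.lt_top)))
    refine (eLpNorm_fourierInv_mul_prod_one_sub_le (hψ i) (hψc i) hψ hψc hψB (s i)).trans ?_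
    gcongr
    · exact hψB i
    · exact le_self_add
    · exact hs i

/-- The bumps are `ψ ∘ h_i^T` for a single `ψ`. The adjoint of `h_i^T` is `h_i`, so linear
invariance gives all of them the norm of `ψ`. They reach 1 on the sets `h_i^{-T} P`, which cover
`U`. -/
theorem exists_isBAPU_orbitFamily {d : ℕ} {I : Type*} {H : Subgroup (GL (Fin d) ℝ)} {h : I → H}
    {U P Q : Set (EuclideanSpace ℝ (Fin d))} (hQ : IsOpen Q) (hQc : IsCompact (closure Q))
    (hPQ : closure P ⊆ Q) (h𝒬 : IsAdmissibleCovering U (orbitFamily h Q))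
    (hP : U = ⋃ i, orbitFamily h P i) :
    ∃ φ : I → EuclideanSpace ℝ (Fin d) → ℂ, IsBAPU U (orbitFamily h Q) φ := by
  obtain ⟨ψ, hψ, hψc, hψs, hψ1⟩ :=
    exists_contDiff_one_on_tsupport_subset isClosed_closure hQ hQc hPQ
  let L : I → EuclideanSpace ℝ (Fin d) ≃L[ℝ] EuclideanSpace ℝ (Fin d) := fun i =>
    matActEquiv (invTranspose (h i : GL (Fin d) ℝ))⁻¹
  let M : I → EuclideanSpace ℝ (Fin d) ≃L[ℝ] EuclideanSpace ℝ (Fin d) := fun i =>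
    matActEquiv (h i : GL (Fin d) ℝ)
  have hLM : ∀ i x y, inner ℝ (L i x) y = inner ℝ x (M i y) := fun i x y =>
    inner_matAct_left _ x y
  have hL : ∀ i x, matAct (invTranspose (h i : GL (Fin d) ℝ)).val (L i x) = x := fun i x =>
    matAct_invTranspose_transpose _ x
  have hL' : ∀ i x, L i (matAct (invTranspose (h i : GL (Fin d) ℝ)).val x) = x := fun i x =>
    matAct_transpose_invTranspose _ x
  refine exists_isBAPU_of_bump h𝒬 (ψ := fun i x => ψ (L i x)) (B := eLpNorm (𝓕⁻ ψ) 1 volume)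
    (fun i => hψ.comp (L i).contDiff) (fun i => hψc.comp_homeomorph (L i).toHomeomorph) ?_ ?_
    ?_ fun i => (eLpNorm_fourierInv_comp_linear (L i) (M i) (hLM i) ψ).le
  · intro i x hx
    refine ⟨L i x, hψs ?_, hL i x⟩
    exact tsupport_comp_subset_preimage ψ (L i).continuous hx
  · intro x hx
    rw [hP] at hx
    obtain ⟨i, p, hp, rfl⟩ := Set.mem_iUnion.1 hx
    exact ⟨i, by rw [hL']; exact hψ1 p (subset_closure hp)⟩
  · exact (memLp_one_iff_integrable.2
      (integrable_fourierInv_of_hasCompactSupport hψ hψc)).eLpNorm_ne_top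

end PartitionOfUnity

/-! ### The main theorem -/

theorem mainTheorem6 {d : ℕ} (H : Subgroup (GL (Fin d) ℝ)) (ξ₀ : EuclideanSpace ℝ (Fin d))
    (hH : IsAdmissibleDilationGroup H ξ₀) {I : Type*} (h : I → H) (hh : IsWellSpread h) :
    -- existence of an induced covering, with the explicit choice `Q = U^{-T} ξ₀`
    (∃ Q, IsInducingSet H ξ₀ h Q) ∧
    (∀ U : Set H, IsCompact (closure U) → IsDenseFamily h U →
      IsInducingSet H ξ₀ h
        ((fun g : H => matAct (invTranspose (g : GL (Fin d) ℝ)).val ξ₀) '' U)) ∧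
    -- every induced covering is admissible, with a bound for neighbouring indices
    (∀ Q, IsInducingSet H ξ₀ h Q →
      IsAdmissibleCovering (dualOrbit H ξ₀) (orbitFamily h Q) ∧
      ∃ C : ℝ, 0 < C ∧ ∀ i, ∀ j ∈ indexCluster (orbitFamily h Q) i,
        ‖matAct (((h i : GL (Fin d) ℝ).val)ᵀ *
          (invTranspose (h j : GL (Fin d) ℝ)).val)‖ ≤ C) ∧
    -- the structured case
    (∀ P Q : Set (EuclideanSpace ℝ (Fin d)), IsOpen Q → IsCompact (closure Q) →
      closure Q ⊆ dualOrbit H ξ₀ → IsOpen P → closure P ⊆ Q →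
      dualOrbit H ξ₀ = ⋃ i, orbitFamily h P i →
      IsStructuredAdmissibleCovering (dualOrbit H ξ₀)
        (fun i => invTranspose (h i : GL (Fin d) ℝ)) (fun _ => 0) P Q (orbitFamily h Q) ∧
      IsDecompositionCovering (dualOrbit H ξ₀) (orbitFamily h Q)) := by
  have hcover : ∀ {Q}, IsInducingSet H ξ₀ h Q →
      IsAdmissibleCovering (dualOrbit H ξ₀) (orbitFamily h Q) :=
    fun hQ => hH.isAdmissibleCovering hh.1 hQ
  obtain ⟨_, hσ⟩ := isClosed_locallyCompact_sigmaCompact hH.isClosed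
  obtain ⟨hsep, W, -, hWc, hWd⟩ := hh
  refine ⟨⟨_, isInducingSet_image hWc hWd⟩, fun U hU hd => isInducingSet_image hU hd,
    fun Q hQ => ⟨hcover hQ, hH.exists_norm_le hQ⟩, ?_⟩
  intro P Q hQo hQc hQO hPo hPQ hP
  have hPc : IsCompact (closure P) :=
    hQc.of_isClosed_subset isClosed_closure (hPQ.trans subset_closure)
  have hPind : IsInducingSet H ξ₀ h P := ⟨hPc, (hPQ.trans subset_closure).trans hQO, hP⟩
  -- The sets `h_i^{-T} Q` cover because the smaller `h_i^{-T} P` do, and they stay inside the orbit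
  -- by invariance.
  have hQind : IsInducingSet H ξ₀ h Q := by
    refine ⟨hQc, hQO, Set.Subset.antisymm ?_ (Set.iUnion_subset fun i => ?_)⟩
    · rw [hP]
      exact Set.iUnion_mono fun i => Set.image_mono (subset_closure.trans hPQ)
    · rintro _ ⟨q, hq, rfl⟩
      exact matAct_invTranspose_mem_dualOrbit (h i) (hQO (subset_closure hq))
  have hne : (dualOrbit H ξ₀).Nonempty := ⟨ξ₀, mem_dualOrbit_self H ξ₀⟩
  have hQne : Q.Nonempty := by
    have hξ := mem_dualOrbit_self H ξ₀
    rw [hP] at hξ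
    obtain ⟨i, p, hp, -⟩ := Set.mem_iUnion.1 hξ
    exact ⟨p, hPQ (subset_closure hp)⟩
  constructor
  · refine ⟨hH.isOpen_orbit, hne, hWd.nonempty, hsep.countable, hPo, hPc, hQo, hQc, hPQ,
      fun i => by simp [orbitFamily], hcover hQind, ?_, ?_⟩
    · simp only [add_zero]
      exact hcover hPind
    · obtain ⟨C, hC0, hC⟩ := hH.exists_norm_le hQind
      refine ⟨C, hC0, fun i j hij => hC i j ?_⟩
      rwa [Set.inter_comm] at hij
  · exact ⟨hH.isOpen_orbit, hne, hcover hQind, fun i => hQne.image _,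
      exists_isBAPU_orbitFamily hQo hQc hPQ (hcover hQind) hP⟩
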